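/- Let $\mu\in(0,1)$, $\alpha=\frac{1+\mu}{2\mu}$, $\delta=\frac{1-\mu}{2\mu}$, let $\nu\ge 0$ be an integer, and for $n=0,1,2,\ldots$ and $x,y>0$ put $$P_n(x)=(-1)^n(\nu+n)!\,n!\sum_{k=0}^n\frac{(\alpha^2-\delta^2)^{k+\frac12}}{\delta^k}\,\frac{(-n)_k}{(\nu+k)!\,k!}\,x^{\frac k2}I_k(2\delta\sqrt x),$$ $$Q_n(y)=(-1)^n\frac{2}{(n!)^2}\sum_{l=0}^n\frac{(\alpha^2-\delta^2)^{l+\nu+\frac12}}{\alpha^{l+\nu}}\,\frac{(-n)_l}{(\nu+l)!\,l!}\,y^{\frac{l+\nu}2}K_{l+\nu}(2\alpha\sqrt y),$$ where $I_\kappa$ and $K_\kappa$ are the modified Bessel functions of the first and second kind and $(a)_k=a(a+1)\cdots(a+k-1)$. (a) For every $n\ge 0$, every $x>0$ and every closed piecewise $C^1$ contour $\Sigma$ that encircles $0,1,\ldots,n$ once in the positive direction (that is, it avoids these points and has winding number $1$ about each of them), $$P_n(x)=\frac{(\nu+n)!\,(n!)^2}{2\pi i}(\alpha^2-\delta^2)^{\frac12}\oint_{\Sigma}\frac{\Gamma(t-n)\,(\alpha^2-\delta^2)^t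 x^t}{\Gamma(t+1)^2\,\Gamma(t+\nu+1)}\;{}_0F_1\!\left(-;t+1;\delta^2x\right)dt .$$ (b) For every $n\ge 0$, every $y>0$ and every $c>0$, $$Q_n(y)=\frac{1}{2\pi i\,(n!)^2(n+\nu)!}\left(1-\frac{\delta^2}{\alpha^2}\right)^{\nu}(\alpha^2-\delta^2)^{\frac12}\int_{c-i\infty}^{c+i\infty}\frac{\Gamma(s)^2\,\Gamma(s+\nu)}{\Gamma(s-n)}\;{}_2F_1\!\left(-n,\nu+s;s-n;\frac{\delta^2}{\alpha^2}\right)(\alpha^2y)^{-s}\,ds .$$ Both integrals converge absolutely (removable singularities of the integrands on the contours being disregarded). -/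

import Mathlib

noncomputable section

namespace DependentGaussian

/-- `α(μ) = (1 + μ) / (2 μ)`. -/
def α (μ : ℝ) : ℝ := (1 + μ) / (2 * μ)

/-- `δ(μ) = (1 - μ) / (2 μ)`. -/
def δ (μ : ℝ) : ℝ := (1 - μ) / (2 * μ)

/-- The modified Bessel function of the first kind `I_κ(z)`, for `z > 0` (and `κ ≥ 0`),
through its power series. -/
def besselI (κ z : ℝ) : ℝ :=
  ∑' m : ℕ, 1 / ((m.factorial : ℝ) * Real.Gamma (κ + m + 1)) * (z / 2) ^ (2 * (m : ℝ) + κ)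

/-- The modified Bessel function of the second kind `K_κ(z)`, for `z > 0`,
`K_κ(z) = ∫₀^∞ exp (-z cosh t) cosh (κ t) dt`. The integral converges absolutely for all
real `κ`, including `κ = 0`. -/
def besselK (κ z : ℝ) : ℝ :=
  ∫ t in Set.Ioi (0 : ℝ), Real.exp (-z * Real.cosh t) * Real.cosh (κ * t)

/-- The function `P_n(x)`; `(-n)_k` is the rising factorial. -/
def P (μ : ℝ) (ν n : ℕ) (x : ℝ) : ℝ :=
  (-1) ^ n * ((ν + n).factorial : ℝ) * (n.factorial : ℝ) *
    ∑ k ∈ Finset.range (n + 1),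
      (α μ ^ 2 - δ μ ^ 2) ^ ((k : ℝ) + 1 / 2) / δ μ ^ k *
        ((ascPochhammer ℝ k).eval (-(n : ℝ)) / (((ν + k).factorial : ℝ) * (k.factorial : ℝ))) *
        x ^ ((k : ℝ) / 2) * besselI k (2 * δ μ * Real.sqrt x)

/-- The function `Q_n(y)`; `(-n)_l` is the rising factorial. -/
def Q (μ : ℝ) (ν n : ℕ) (y : ℝ) : ℝ :=
  (-1) ^ n * (2 / (n.factorial : ℝ) ^ 2) *
    ∑ l ∈ Finset.range (n + 1),
      (α μ ^ 2 - δ μ ^ 2) ^ ((l : ℝ) + ν + 1 / 2) / α μ ^ (l + ν) *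
        ((ascPochhammer ℝ l).eval (-(n : ℝ)) / (((ν + l).factorial : ℝ) * (l.factorial : ℝ))) *
        y ^ (((l : ℝ) + ν) / 2) * besselK ((l : ℝ) + ν) (2 * α μ * Real.sqrt y)

/-- The confluent hypergeometric limit function `₀F₁(-; b; z) = ∑ z^k / ((b)_k k!)`. -/
def hypergeometric0F1 (b z : ℂ) : ℂ :=
  ∑' k : ℕ, z ^ k / ((ascPochhammer ℂ k).eval b * (k.factorial : ℂ))

/-- A path is piecewise `C¹`: finitely many points subdivide `[0, 1]` into closed intervals on
each of which the path is `C¹` (with one-sided derivatives at the endpoints). -/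
def IsPiecewiseC1 {a b : ℂ} (γ : Path a b) : Prop :=
  ∃ S : Finset ℝ, ∀ u v : ℝ, 0 ≤ u → u < v → v ≤ 1 → Disjoint (Set.Ioo u v) (S : Set ℝ) →
    ContDiffOn ℝ 1 γ.extend (Set.Icc u v)

/-- The complex 1-form `f(z) dz`. -/
def formDz (f : ℂ → ℂ) (z : ℂ) : ℂ →L[ℂ] ℂ := f z • ContinuousLinearMap.id ℂ ℂ

/-- The contour integral `∫_γ f(z) dz`. -/
def contourIntegral {a b : ℂ} (γ : Path a b) (f : ℂ → ℂ) : ℂ :=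
  curveIntegral (formDz f) γ

/-- The winding number `(1 / 2πi) ∫_γ dz / (z - w)` of a closed contour about `w`. -/
def windingNumber {a : ℂ} (γ : Path a a) (w : ℂ) : ℂ :=
  1 / (2 * Real.pi * Complex.I) * contourIntegral γ (fun z => 1 / (z - w))

/-- `γ` is a closed (piecewise `C¹`) contour that encircles `0, 1, …, n` once in the positive
direction: it avoids these points and has winding number `1` about each of them. -/
structure EncirclesOnce {a : ℂ} (γ : Path a a) (n : ℕ) : Prop where
  piecewiseC1 : IsPiecewiseC1 γ
  avoids : ∀ k : ℕ, k ≤ n → (k : ℂ) ∉ Set.range γ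
  winding : ∀ k : ℕ, k ≤ n → windingNumber γ (k : ℂ) = 1

/-- The integral `∫_{c - i∞}^{c + i∞} f(s) ds`. -/
def verticalIntegral (c : ℝ) (f : ℂ → ℂ) : ℂ :=
  Complex.I * ∫ τ : ℝ, f ((c : ℂ) + τ * Complex.I)

/-- The integrand of the representation of `P_n(x)`. -/
def integrandP (μ : ℝ) (ν n : ℕ) (x : ℝ) (t : ℂ) : ℂ :=
  Complex.Gamma (t - n) * ((α μ ^ 2 - δ μ ^ 2 : ℝ) : ℂ) ^ t * (x : ℂ) ^ t /
      (Complex.Gamma (t + 1) ^ 2 * Complex.Gamma (t + ν + 1)) *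
    hypergeometric0F1 (t + 1) ((δ μ ^ 2 * x : ℝ) : ℂ)

/-- The integrand of the representation of `Q_n(y)`. -/
def integrandQ (μ : ℝ) (ν n : ℕ) (y : ℝ) (s : ℂ) : ℂ :=
  Complex.Gamma s ^ 2 * Complex.Gamma (s + ν) / Complex.Gamma (s - n) *
    ordinaryHypergeometric (-(n : ℂ)) ((ν : ℂ) + s) (s - n) ((δ μ ^ 2 / α μ ^ 2 : ℝ) : ℂ) *
    ((α μ ^ 2 * y : ℝ) : ℂ) ^ (-s)

end DependentGaussian

end

open DependentGaussian

/-!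
Since `Γ(t - n) / Γ(t + 1) = 1 / ∏_{j ≤ n} (t - j)` and `₀F₁(-; t + 1; z) / Γ(t + 1)` is entire
in `t`, the integrand of (a) is an entire function divided by `∏_{j ≤ n} (t - j)`. Its residues at
`0, …, n` are the terms of `P_n`, because `₀F₁(-; k + 1; δ² x) / k!` is a multiple of
`x^(-k/2) I_k(2δ√x)`.

For (b), the transformation `q ↦ 1 - q` of a terminating `₂F₁` turns the integrand into a linear
combination of the functions `Γ(s) Γ(s + l + ν) Y^(-s)` with `Y = α² y` and `l ≤ n`. The product
`Γ(s) Γ(s + κ)` is the Mellin transform of the multiplicative convolution of `e^(-u)` and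
`u^κ e^(-u)`, which the substitution `u = √Y e^t` identifies with `2 Y^(κ/2) K_κ(2√Y)`, and Mellin
inversion returns the terms of `Q_n`.
-/

namespace DependentGaussian

open Filter MeasureTheory Set Topology

section Pochhammer

variable {R : Type*} [CommRing R]

theorem ascPochhammer_succ_eval_left (n : ℕ) (x : R) :
    (ascPochhammer R (n + 1)).eval x = x * (ascPochhammer R n).eval (x + 1) := by
  simp [ascPochhammer_succ_left, Polynomial.eval_comp]

theorem ascPochhammer_add_eval (k m : ℕ) (x : R) :
    (ascPochhammer R (k + m)).eval x =
      (ascPochhammer R k).eval x * (ascPochhammer R m).eval (x + k) := by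
  simp [← ascPochhammer_mul, Polynomial.eval_comp]

theorem ascPochhammer_eval_neg_natCast (n k : ℕ) :
    (ascPochhammer R k).eval (-(n : R)) = (-1) ^ k * (n.choose k * k.factorial) := by
  rw [ascPochhammer_eval_neg_eq_descPochhammer, descPochhammer_eval_eq_descFactorial,
    Nat.descFactorial_eq_factorial_mul_choose, Nat.cast_mul, mul_comm (k.factorial : R)]

theorem ascPochhammer_eval_sub_natCast (n : ℕ) (t : R) :
    (ascPochhammer R (n + 1)).eval (t - n) = ∏ j ∈ Finset.range (n + 1), (t - j) := by
  rw [← descPochhammer_eval_eq_prod_range, descPochhammer_eval_eq_ascPochhammer]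
  congr 1
  push_cast
  ring

/-- The terminating Gauss sum `(d)_n ₂F₁(-n, b; d; q)`, written without denominators as
`∑_{i + j = n} C(n, i) (-q)^i (b)_i (d + i)_j`, so that it makes sense in every commutative ring
and for every `d`. -/
noncomputable def terminatingGaussSum (n : ℕ) (b d q : R) : R :=
  ∑ ij ∈ Finset.HasAntidiagonal.antidiagonal n, (n.choose ij.1 : R) *
    ((-q) ^ ij.1 * (ascPochhammer R ij.1).eval b * (ascPochhammer R ij.2).eval (d + ij.1))

theorem terminatingGaussSum_succ (n : ℕ) (b d q : R) :
    terminatingGaussSum (n + 1) b d q =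
      (d + n) * terminatingGaussSum n b d q -
        q * b * terminatingGaussSum n (b + 1) (d + 1) q := by
  simp only [terminatingGaussSum]
  rw [Finset.sum_antidiagonal_choose_succ_mul
    (fun i j => (-q) ^ i * (ascPochhammer R i).eval b * (ascPochhammer R j).eval (d + i)),
    Finset.mul_sum, Finset.mul_sum, sub_eq_add_neg, ← Finset.sum_neg_distrib]
  congr 1
  · refine Finset.sum_congr rfl fun ij hij => ?_
    have hn : ((ij.1 : R) + ij.2) = n := by
      exact_mod_cast congrArg (Nat.cast (R := R)) (Finset.HasAntidiagonal.mem_antidiagonal.mp hij)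
    rw [ascPochhammer_succ_eval, ← hn]
    ring
  · refine Finset.sum_congr rfl fun ij hij => ?_
    have hchoose : n.choose ij.2 = n.choose ij.1 :=
      (Nat.choose_symm_of_eq_add (Finset.HasAntidiagonal.mem_antidiagonal.mp hij).symm).symm
    rw [ascPochhammer_succ_eval_left, hchoose, Nat.cast_succ, add_comm (ij.1 : R) 1, ← add_assoc]
    ring

theorem terminatingGaussSum_contiguous (n : ℕ) (b d q : R) :
    (d + n) * terminatingGaussSum n b d q =
      b * terminatingGaussSum n (b + 1) (d + 1) q -
        (b - d) * terminatingGaussSum n b (d + 1) q := by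
  simp only [terminatingGaussSum, Finset.mul_sum, ← Finset.sum_sub_distrib]
  refine Finset.sum_congr rfl fun ij hij => ?_
  have hn : ((ij.1 : R) + ij.2) = n := by
    exact_mod_cast congrArg (Nat.cast (R := R)) (Finset.HasAntidiagonal.mem_antidiagonal.mp hij)
  have hb : b * (ascPochhammer R ij.1).eval (b + 1) =
      (ascPochhammer R ij.1).eval b * (b + ij.1) := by
    rw [← ascPochhammer_succ_eval_left, ascPochhammer_succ_eval]
  have hd : (d + ij.1) * (ascPochhammer R ij.2).eval (d + 1 + ij.1) =
      (ascPochhammer R ij.2).eval (d + ij.1) * (d + n) := by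
    rw [show d + 1 + (ij.1 : R) = d + ij.1 + 1 by ring, ← ascPochhammer_succ_eval_left,
      ascPochhammer_succ_eval, ← hn]
    ring
  linear_combination
    -(n.choose ij.1 * (-q) ^ ij.1 * (ascPochhammer R ij.2).eval (d + 1 + ij.1)) * hb
    - (n.choose ij.1 * (-q) ^ ij.1 * (ascPochhammer R ij.1).eval b) * hd

theorem terminatingGaussSum_one_sub (n : ℕ) (b d q : R) :
    terminatingGaussSum n b (b - d - n + 1) q =
      (-1) ^ n * terminatingGaussSum n b d (1 - q) := by
  induction n generalizing b d with
  | zero => simp [terminatingGaussSum]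
  | succ n ih =>
    have ih₀ := ih b (d + 1)
    have ih₁ := ih (b + 1) (d + 1)
    rw [show b - (d + 1) - n + 1 = b - d - n by ring] at ih₀
    rw [show b + 1 - (d + 1) - n + 1 = b - d - n + 1 by ring] at ih₁
    push_cast
    rw [show b - d - ((n : R) + 1) + 1 = b - d - n by ring, terminatingGaussSum_succ,
      terminatingGaussSum_succ, ih₀, ih₁, pow_succ]
    linear_combination (-1) ^ n * terminatingGaussSum_contiguous n b d (1 - q)

end Pochhammer

section TerminatingHypergeometric

variable {K : Type*} [Field K] [CharZero K]

theorem ascPochhammer_eval_natCast_add_one (m k : ℕ) :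
    (ascPochhammer K k).eval ((m : K) + 1) = (m + k).factorial / m.factorial := by
  rw [eq_div_iff (by exact_mod_cast m.factorial_ne_zero), mul_comm]
  exact_mod_cast factorial_mul_ascPochhammer K m k

variable [TopologicalSpace K] [IsTopologicalRing K]

theorem ordinaryHypergeometric_neg_natCast (n : ℕ) (b d q : K) :
    ordinaryHypergeometric (-(n : K)) b d q = ∑ k ∈ Finset.range (n + 1),
      (n.choose k : K) * ((-q) ^ k * (ascPochhammer K k).eval b / (ascPochhammer K k).eval d) := by
  rw [ordinaryHypergeometric_eq_tsum]
  beta_reduce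
  rw [tsum_eq_sum (s := Finset.range (n + 1))]
  · refine Finset.sum_congr rfl fun k _ => ?_
    have hk : (k.factorial : K) ≠ 0 := by exact_mod_cast k.factorial_ne_zero
    rw [ascPochhammer_eval_neg_natCast, smul_eq_mul, neg_pow q]
    field_simp
  · intro k hk
    rw [ascPochhammer_eval_neg_coe_nat_of_lt (by simpa using hk)]
    simp

theorem ascPochhammer_mul_ordinaryHypergeometric_neg_natCast (n : ℕ) (b q : K) {d : K}
    (hd : (ascPochhammer K n).eval d ≠ 0) :
    (ascPochhammer K n).eval d * ordinaryHypergeometric (-(n : K)) b d q =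
      terminatingGaussSum n b d q := by
  rw [ordinaryHypergeometric_neg_natCast, terminatingGaussSum,
    Finset.Nat.sum_antidiagonal_eq_sum_range_succ_mk, Finset.mul_sum]
  refine Finset.sum_congr rfl fun k hk => ?_
  have hsplit := ascPochhammer_add_eval k (n - k) d
  rw [Nat.add_sub_cancel' (Finset.mem_range_succ_iff.mp hk)] at hsplit
  have hk0 : (ascPochhammer K k).eval d ≠ 0 := left_ne_zero_of_mul (hsplit ▸ hd)
  rw [hsplit]
  field_simp

end TerminatingHypergeometric

section ContourIntegral

variable {a b : ℂ}

theorem curveIntegralFun_formDz (γ : Path a b) (f : ℂ → ℂ) (t : ℝ) :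
    curveIntegralFun (formDz f) γ t = f (γ.extend t) * derivWithin γ.extend (Icc 0 1) t := by
  simp [curveIntegralFun_def, formDz]

theorem contourIntegral_eq_intervalIntegral (γ : Path a b) (f : ℂ → ℂ) :
    contourIntegral γ f =
      ∫ t in (0 : ℝ)..1, f (γ.extend t) * derivWithin γ.extend (Icc 0 1) t := by
  simp [contourIntegral, curveIntegral_def, curveIntegralFun_formDz]

theorem curveIntegrable_formDz_iff (γ : Path a b) (f : ℂ → ℂ) :
    CurveIntegrable (formDz f) γ ↔ IntervalIntegrable
      (fun t => f (γ.extend t) * derivWithin γ.extend (Icc 0 1) t) volume 0 1 := by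
  simp only [CurveIntegrable, ← curveIntegralFun_formDz]

theorem contourIntegral_add (γ : Path a b) {f g : ℂ → ℂ}
    (hf : CurveIntegrable (formDz f) γ) (hg : CurveIntegrable (formDz g) γ) :
    contourIntegral γ (fun z => f z + g z) = contourIntegral γ f + contourIntegral γ g := by
  simp only [contourIntegral_eq_intervalIntegral, add_mul]
  exact intervalIntegral.integral_add ((curveIntegrable_formDz_iff γ f).mp hf)
    ((curveIntegrable_formDz_iff γ g).mp hg)

theorem contourIntegral_sum (γ : Path a b) {ι : Type*} (s : Finset ι) {f : ι → ℂ → ℂ}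
    (hf : ∀ i ∈ s, CurveIntegrable (formDz (f i)) γ) :
    contourIntegral γ (fun z => ∑ i ∈ s, f i z) = ∑ i ∈ s, contourIntegral γ (f i) := by
  simp only [contourIntegral_eq_intervalIntegral, Finset.sum_mul]
  exact intervalIntegral.integral_finsetSum fun i hi =>
    (curveIntegrable_formDz_iff γ (f i)).mp (hf i hi)

theorem contourIntegral_const_mul (γ : Path a b) (c : ℂ) (f : ℂ → ℂ) :
    contourIntegral γ (fun z => c * f z) = c * contourIntegral γ f := by
  simp only [contourIntegral_eq_intervalIntegral, mul_assoc, intervalIntegral.integral_const_mul]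

theorem intervalIntegrable_of_forall_disjoint_Ioo {E : Type*} [NormedAddCommGroup E] {g : ℝ → E}
    (S : Finset ℝ) {p q : ℝ} (hpq : p ≤ q)
    (h : ∀ u v : ℝ, p ≤ u → u < v → v ≤ q → Disjoint (Ioo u v) (S : Set ℝ) →
      IntervalIntegrable g volume u v) :
    IntervalIntegrable g volume p q := by
  induction S using Finset.induction_on generalizing p q with
  | empty =>
    rcases hpq.eq_or_lt with rfl | hlt
    · exact IntervalIntegrable.refl
    · exact h p q le_rfl hlt le_rfl (by simp)
  | insert s S _ ih =>
    have of_notMem {p' q' : ℝ} (hp : p ≤ p') (hpq' : p' ≤ q') (hq : q' ≤ q)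
        (hs : s ∉ Ioo p' q') : IntervalIntegrable g volume p' q' :=
      ih hpq' fun u v hu huv hv hd => h u v (hp.trans hu) huv (hv.trans hq) <| by
        rw [Finset.coe_insert, disjoint_insert_right]
        exact ⟨fun hsuv => hs (Ioo_subset_Ioo hu hv hsuv), hd⟩
    by_cases hs : s ∈ Ioo p q
    · exact (of_notMem le_rfl hs.1.le hs.2.le (by simp)).trans
        (of_notMem hs.1.le hs.2.le le_rfl (by simp))
    · exact of_notMem le_rfl hpq le_rfl hs

namespace IsPiecewiseC1

variable {γ : Path a b}

theorem curveIntegrable (hγ : IsPiecewiseC1 γ) {f : ℂ → ℂ} (hf : ContinuousOn f (range γ)) :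
    CurveIntegrable (formDz f) γ := by
  rw [curveIntegrable_formDz_iff]
  obtain ⟨S, hS⟩ := hγ
  refine intervalIntegrable_of_forall_disjoint_Ioo S zero_le_one fun u v hu huv hv hd => ?_
  have hcont : ContinuousOn
      (fun t => f (γ.extend t) * derivWithin γ.extend (Icc u v) t) (Icc u v) := by
    refine (hf.comp γ.continuous_extend.continuousOn fun t _ => ?_).mul
      ((hS u v hu huv hv hd).continuousOn_derivWithin (uniqueDiffOn_Icc huv) le_rfl)
    exact γ.extend_range ▸ mem_range_self t
  refine (hcont.intervalIntegrable_of_Icc huv.le).congr_ae ?_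
  rw [uIoc_of_le huv.le, ← restrict_Ioo_eq_restrict_Ioc]
  filter_upwards [ae_restrict_mem measurableSet_Ioo] with t ht
  rw [derivWithin_of_mem_nhds (Icc_mem_nhds ht.1 ht.2),
    derivWithin_of_mem_nhds (Icc_mem_nhds (hu.trans_lt ht.1) (ht.2.trans_le hv))]

theorem exists_finset_differentiableAt (hγ : IsPiecewiseC1 γ) :
    ∃ S : Finset ℝ, ∀ t ∈ Ioo (0 : ℝ) 1 \ S, DifferentiableAt ℝ γ.extend t := by
  obtain ⟨S, hS⟩ := hγ
  refine ⟨S, fun t ht => ?_⟩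
  have hnhds : Ioo (0 : ℝ) 1 \ S ∈ 𝓝 t :=
    (isOpen_Ioo.sdiff S.finite_toSet.isClosed).mem_nhds ht
  obtain ⟨u, v, -, htuv, hsub⟩ := exists_Icc_mem_subset_of_mem_nhds hnhds
  obtain ⟨hut, htv⟩ := Icc_mem_nhds_iff.mp htuv
  have huv : u < v := hut.trans htv
  have hC1 := hS u v (hsub (left_mem_Icc.mpr huv.le)).1.1.le huv
    (hsub (right_mem_Icc.mpr huv.le)).1.2.le
    (disjoint_left.mpr fun x hx => (hsub (Ioo_subset_Icc_self hx)).2)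
  exact (hC1.differentiableOn one_ne_zero t ⟨hut.le, htv.le⟩).differentiableAt htuv

theorem contourIntegral_eq_sub (hγ : IsPiecewiseC1 γ) {f F : ℂ → ℂ}
    (hf : ContinuousOn f (range γ)) (hF : ∀ z ∈ range γ, HasDerivAt F (f z) z) :
    contourIntegral γ f = F b - F a := by
  have hmem (t : ℝ) : γ.extend t ∈ range γ := γ.extend_range ▸ mem_range_self t
  obtain ⟨S, hS⟩ := hγ.exists_finset_differentiableAt
  rw [contourIntegral_eq_intervalIntegral,
    integral_eq_of_hasDerivAt_off_countable_of_le
      (fun t => F (γ.extend t)) _ zero_le_one S.countable_toSet ?_ ?_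
      ((curveIntegrable_formDz_iff γ f).mp (hγ.curveIntegrable hf)),
    γ.extend_one, γ.extend_zero]
  · exact fun t _ => ((hF _ (hmem t)).continuousAt.comp
      γ.continuous_extend.continuousAt).continuousWithinAt
  · intro t ht
    rw [derivWithin_of_mem_nhds (Icc_mem_nhds ht.1.1 ht.1.2)]
    exact (hF _ (hmem t)).comp_of_eq t (hS t ht).hasDerivAt rfl

theorem contourIntegral_eq_zero_of_differentiable {γ : Path a a} (hγ : IsPiecewiseC1 γ)
    {f : ℂ → ℂ} (hf : Differentiable ℂ f) : contourIntegral γ f = 0 := by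
  obtain ⟨F, hF⟩ := hf.isExactOn_univ
  rw [hγ.contourIntegral_eq_sub hf.continuous.continuousOn fun z _ => hF z (mem_univ z), sub_self]

end IsPiecewiseC1

theorem countable_setOf_eq_and_derivWithin_ne_zero {E : Type*} [NormedAddCommGroup E]
    [NormedSpace ℝ E] (f : ℝ → E) (s : Set ℝ) (w : E) :
    {t ∈ s | f t = w ∧ derivWithin f s t ≠ 0}.Countable := by
  refine (countable_setOfPred_isolated_right_within (s := {t ∈ s | f t = w})).mono ?_
  rintro t ⟨hts, htw, hd⟩
  refine ⟨⟨hts, htw⟩, empty_mem_iff_bot.mp ?_⟩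
  have hne := (differentiableWithinAt_of_derivWithin_ne_zero hd).hasDerivWithinAt.eventually_ne
    (c := w) hd
  have hsub : {t ∈ s | f t = w} ∩ Ioi t ⊆ s \ {t} := fun x hx => ⟨hx.1.1, hx.2.ne'⟩
  filter_upwards [nhdsWithin_mono t hsub hne, self_mem_nhdsWithin] with x hxne hx
  exact hxne hx.1.2

section Congr

variable (γ : Path a b) {f g : ℂ → ℂ} {T : Set ℂ} (hT : T.Countable)
  (hfg : ∀ z ∈ range γ, z ∉ T → f z = g z)

include hT hfg

theorem curveIntegralFun_formDz_congr_ae :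
    curveIntegralFun (formDz f) γ =ᵐ[volume.restrict (uIoc 0 1)]
      curveIntegralFun (formDz g) γ := by
  have hnull := (hT.biUnion fun w _ =>
    countable_setOf_eq_and_derivWithin_ne_zero γ.extend (Icc 0 1) w).ae_notMem
      (volume : Measure ℝ)
  rw [uIoc_of_le zero_le_one]
  filter_upwards [ae_restrict_of_ae hnull, ae_restrict_mem measurableSet_Ioc] with t ht ht01
  rw [curveIntegralFun_formDz, curveIntegralFun_formDz]
  by_cases htT : γ.extend t ∈ T
  · have hderiv : derivWithin γ.extend (Icc 0 1) t = 0 := by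
      by_contra hd
      exact ht (mem_biUnion htT ⟨Ioc_subset_Icc_self ht01, rfl, hd⟩)
    rw [hderiv, mul_zero, mul_zero]
  · rw [hfg _ (γ.extend_range ▸ mem_range_self t) htT]

theorem contourIntegral_congr_off_countable : contourIntegral γ f = contourIntegral γ g := by
  rw [contourIntegral, contourIntegral, curveIntegral_def, curveIntegral_def]
  exact intervalIntegral.integral_congr_ae_restrict (curveIntegralFun_formDz_congr_ae γ hT hfg)

theorem curveIntegrable_formDz_congr_off_countable :
    CurveIntegrable (formDz f) γ ↔ CurveIntegrable (formDz g) γ :=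
  have hae := curveIntegralFun_formDz_congr_ae γ hT hfg
  ⟨fun hf => IntervalIntegrable.congr_ae hf hae, fun hg => IntervalIntegrable.congr_ae hg hae.symm⟩

end Congr

end ContourIntegral

section Residues

variable {a : ℂ} {γ : Path a a} {E : ℂ → ℂ}

theorem continuousOn_div_sub (hE : Differentiable ℂ E) {w : ℂ} (hw : w ∉ range γ) :
    ContinuousOn (fun z => E z / (z - w)) (range γ) :=
  hE.continuous.continuousOn.div (by fun_prop) fun _ hz =>
    sub_ne_zero.mpr fun h => hw (h ▸ hz)

theorem IsPiecewiseC1.contourIntegral_div_sub (hγ : IsPiecewiseC1 γ) (hE : Differentiable ℂ E)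
    {w : ℂ} (hw : w ∉ range γ) :
    contourIntegral γ (fun z => E z / (z - w)) =
      2 * Real.pi * Complex.I * windingNumber γ w * E w := by
  have hdslope : Differentiable ℂ (dslope E w) := by
    rw [← differentiableOn_univ] at hE ⊢
    exact (Complex.differentiableOn_dslope univ_mem).mpr hE
  have hsplit : ∀ z ∈ range γ, z ∉ (∅ : Set ℂ) →
      E z / (z - w) = dslope E w z + E w * (1 / (z - w)) := by
    intro z hz _
    have hzw : z ≠ w := fun h => hw (h ▸ hz)
    rw [dslope_of_ne _ hzw, slope_def_field]
    ring
  have hcont : ContinuousOn (fun z => E w * (1 / (z - w))) (range γ) :=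
    continuousOn_const.mul (continuousOn_div_sub (differentiable_const 1) hw)
  rw [contourIntegral_congr_off_countable γ countable_empty hsplit,
    contourIntegral_add γ (hγ.curveIntegrable hdslope.continuous.continuousOn)
      (hγ.curveIntegrable hcont),
    hγ.contourIntegral_eq_zero_of_differentiable hdslope, zero_add, contourIntegral_const_mul,
    windingNumber]
  have := Complex.two_pi_I_ne_zero
  field_simp

variable {ι : Type*} {s : Finset ι} {v : ι → ℂ}

theorem IsPiecewiseC1.curveIntegrable_div_prod_sub (hγ : IsPiecewiseC1 γ)
    (hE : Differentiable ℂ E) (hvγ : ∀ i ∈ s, v i ∉ range γ) :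
    CurveIntegrable (formDz fun z => E z / ∏ i ∈ s, (z - v i)) γ :=
  hγ.curveIntegrable <| hE.continuous.continuousOn.div (by fun_prop) fun z hz =>
    Finset.prod_ne_zero_iff.mpr fun i hi => sub_ne_zero.mpr fun h => hvγ i hi (h ▸ hz)

variable [DecidableEq ι]

theorem inv_prod_sub_eq_sum_nodalWeight {F : Type*} [Field F] {v : ι → F} (hs : s.Nonempty)
    (hv : Set.InjOn v s) {z : F} (hz : ∀ i ∈ s, z ≠ v i) :
    (∏ i ∈ s, (z - v i))⁻¹ = ∑ i ∈ s, Lagrange.nodalWeight s v i / (z - v i) := by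
  have h := Lagrange.eval_interpolate_not_at_node 1 hz
  rw [Lagrange.interpolate_one hv hs, Polynomial.eval_one, Lagrange.eval_nodal] at h
  rw [inv_eq_of_mul_eq_one_right h.symm]
  exact Finset.sum_congr rfl fun i _ => by rw [Pi.one_apply, mul_one, div_eq_mul_inv]

theorem div_prod_sub_eq_sum_nodalWeight (hs : s.Nonempty) (hv : Set.InjOn v s)
    (hvγ : ∀ i ∈ s, v i ∉ range γ) {z : ℂ} (hz : z ∈ range γ) :
    E z / ∏ i ∈ s, (z - v i) = ∑ i ∈ s, Lagrange.nodalWeight s v i * (E z / (z - v i)) := by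
  rw [div_eq_mul_inv, inv_prod_sub_eq_sum_nodalWeight hs hv fun i hi h => hvγ i hi (h ▸ hz),
    Finset.mul_sum]
  exact Finset.sum_congr rfl fun i _ => by ring

theorem IsPiecewiseC1.contourIntegral_div_prod_sub (hγ : IsPiecewiseC1 γ)
    (hE : Differentiable ℂ E) (hs : s.Nonempty) (hv : Set.InjOn v s)
    (hvγ : ∀ i ∈ s, v i ∉ range γ) :
    contourIntegral γ (fun z => E z / ∏ i ∈ s, (z - v i)) =
      2 * Real.pi * Complex.I *
        ∑ i ∈ s, Lagrange.nodalWeight s v i * windingNumber γ (v i) * E (v i) := by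
  rw [contourIntegral_congr_off_countable γ countable_empty fun z hz _ =>
      div_prod_sub_eq_sum_nodalWeight (E := E) hs hv hvγ hz,
    contourIntegral_sum γ s (f := fun i z => Lagrange.nodalWeight s v i * (E z / (z - v i)))
      fun i hi => hγ.curveIntegrable
        (continuousOn_const.mul (continuousOn_div_sub hE (hvγ i hi))), Finset.mul_sum]
  refine Finset.sum_congr rfl fun i hi => ?_
  rw [contourIntegral_const_mul, hγ.contourIntegral_div_sub hE (hvγ i hi)]
  ring

end Residues

section NodalWeight

variable {F : Type*} [Field F]

theorem prod_range_erase_natCast_sub {n k : ℕ} (hk : k ≤ n) :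
    ∏ j ∈ (Finset.range (n + 1)).erase k, ((k : F) - j) =
      (-1) ^ (n - k) * (k.factorial * (n - k).factorial) := by
  induction n, hk using Nat.le_induction with
  | base =>
    rw [Finset.range_add_one, Finset.erase_insert (by simp), ← descPochhammer_eval_eq_prod_range,
      descPochhammer_eval_eq_descFactorial, Nat.descFactorial_self]
    simp
  | succ n hk ih =>
    rw [Finset.range_add_one, Finset.erase_insert_of_ne (by omega),
      Finset.prod_insert (by simp), ih, Nat.succ_sub hk, pow_succ, Nat.factorial_succ]
    push_cast [Nat.cast_sub hk]
    ring

theorem nodalWeight_range_natCast [CharZero F] {n k : ℕ} (hk : k ≤ n) :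
    Lagrange.nodalWeight (Finset.range (n + 1)) (Nat.cast : ℕ → F) k =
      (-1) ^ n * (ascPochhammer F k).eval (-(n : F)) / (n.factorial * k.factorial) := by
  have hsign : (-1 : F) ^ n * (-1) ^ k * (-1) ^ (n - k) = 1 := by
    rw [mul_assoc, ← pow_add, Nat.add_sub_cancel' hk, ← mul_pow, neg_one_mul, neg_neg, one_pow]
  have hfactorial : (n.factorial : F) = n.choose k * k.factorial * (n - k).factorial := by
    exact_mod_cast (Nat.choose_mul_factorial_mul_factorial hk).symm
  have hchoose : (n.choose k : F) ≠ 0 := by exact_mod_cast (Nat.choose_pos hk).ne'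
  have hkfac : (k.factorial : F) ≠ 0 := by exact_mod_cast k.factorial_ne_zero
  have hnkfac : ((n - k).factorial : F) ≠ 0 := by exact_mod_cast (n - k).factorial_ne_zero
  rw [Lagrange.nodalWeight, Finset.prod_inv_distrib, prod_range_erase_natCast_sub hk,
    ascPochhammer_eval_neg_natCast, hfactorial]
  apply inv_eq_of_mul_eq_one_left
  field_simp
  linear_combination hsign

end NodalWeight

section Regularized0F1

/-- The regularized confluent hypergeometric limit function
`₀F₁(-; b; z) / Γ(b) = ∑ z^k / (k! Γ(b + k))`. Unlike `₀F₁` itself it is entire in `b`, because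
Lean's `Γ` vanishes at its poles and so `(Γ s)⁻¹` is the entire function `1 / Γ`. -/
noncomputable def regularized0F1 (b z : ℂ) : ℂ :=
  ∑' k : ℕ, z ^ k / (k.factorial : ℂ) * (Complex.Gamma (b + k))⁻¹

theorem hypergeometric0F1_div_Gamma {b : ℂ} (hb : ∀ m : ℕ, b ≠ -m) (z : ℂ) :
    hypergeometric0F1 b z / Complex.Gamma b = regularized0F1 b z := by
  rw [hypergeometric0F1, regularized0F1, ← tsum_div_const]
  refine tsum_congr fun k => ?_
  have hGamma := Complex.Gamma_ne_zero hb
  have hGamma_add : Complex.Gamma (b + k) ≠ 0 := by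
    refine Complex.Gamma_ne_zero fun m h => hb (m + k) ?_
    push_cast
    linear_combination h
  rw [← Complex.Gamma_add_nat_div_Gamma_eq _ hb]
  field_simp

theorem norm_inv_Gamma_add_one_le {s : ℂ} (hs : 1 ≤ ‖s‖) :
    ‖(Complex.Gamma (s + 1))⁻¹‖ ≤ ‖(Complex.Gamma s)⁻¹‖ := by
  have hs0 : s ≠ 0 := norm_pos_iff.mp (zero_lt_one.trans_le hs)
  rw [Complex.Gamma_add_one s hs0, mul_inv, norm_mul, norm_inv s]
  exact mul_le_of_le_one_left (norm_nonneg _) (inv_le_one_of_one_le₀ hs)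

theorem exists_norm_inv_Gamma_add_natCast_le (R : ℝ) :
    ∃ M : ℝ, ∀ k : ℕ, ∀ b : ℂ, ‖b‖ ≤ R → ‖(Complex.Gamma (b + k))⁻¹‖ ≤ M := by
  obtain ⟨N, hN⟩ := exists_nat_ge (R + 1)
  have hcont : Continuous fun p : ℕ × ℂ => (Complex.Gamma (p.2 + p.1))⁻¹ :=
    Complex.differentiable_one_div_Gamma.continuous.comp (by fun_prop)
  obtain ⟨M, hM⟩ := ((finite_Iic N).isCompact.prod
    (isCompact_closedBall (0 : ℂ) R)).exists_bound_of_continuousOn hcont.continuousOn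
  refine ⟨M, fun k b hb => ?_⟩
  have hsmall (k : ℕ) (hk : k ≤ N) : ‖(Complex.Gamma (b + k))⁻¹‖ ≤ M :=
    hM (k, b) ⟨hk, by simpa using hb⟩
  rcases le_total k N with hk | hk
  · exact hsmall k hk
  induction k, hk using Nat.le_induction with
  | base => exact hsmall N le_rfl
  | succ k hk ih =>
    have hnorm : 1 ≤ ‖b + k‖ := by
      have hkN : (N : ℝ) ≤ k := by exact_mod_cast hk
      have htriangle := norm_sub_le (b + k) b
      rw [add_sub_cancel_left, Complex.norm_natCast] at htriangle
      linarith
    rw [Nat.cast_succ, ← add_assoc]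
    exact (norm_inv_Gamma_add_one_le hnorm).trans ih

theorem differentiable_regularized0F1 (z : ℂ) : Differentiable ℂ fun b => regularized0F1 b z := by
  intro b
  obtain ⟨M, hM⟩ := exists_norm_inv_Gamma_add_natCast_le (‖b‖ + 1)
  have hdiff : DifferentiableOn ℂ (fun b => regularized0F1 b z) (Metric.ball 0 (‖b‖ + 1)) := by
    refine Complex.differentiableOn_tsum_of_summable_norm
      ((Real.summable_pow_div_factorial ‖z‖).mul_right M) (fun k => ?_) Metric.isOpen_ball ?_
    · exact ((Complex.differentiable_one_div_Gamma.comp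
        (differentiable_id.add_const (k : ℂ))).const_mul _).differentiableOn
    · intro k w hw
      rw [norm_mul, norm_div, norm_pow, Complex.norm_natCast]
      gcongr
      exact hM k w (mem_ball_zero_iff.mp hw).le
  exact hdiff.differentiableAt (Metric.isOpen_ball.mem_nhds (by simp))

theorem besselI_natCast (k : ℕ) (d : ℝ) {x : ℝ} (hx : 0 ≤ x) :
    (besselI k (2 * d * √x) : ℂ) =
      ((d * √x) ^ k : ℝ) * regularized0F1 (k + 1) ((d ^ 2 * x : ℝ) : ℂ) := by
  rw [besselI, regularized0F1, Complex.ofReal_tsum, ← tsum_mul_left]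
  refine tsum_congr fun m => ?_
  have hGamma : Complex.Gamma ((k : ℂ) + 1 + m) = (Real.Gamma ((k : ℝ) + m + 1) : ℝ) := by
    rw [← Complex.Gamma_ofReal]
    push_cast
    ring_nf
  have hpow : (2 * d * √x / 2) ^ (2 * (m : ℝ) + k) = (d * √x) ^ k * (d ^ 2 * x) ^ m := by
    rw [mul_assoc 2 d, mul_div_cancel_left₀ _ two_ne_zero,
      show 2 * (m : ℝ) + k = ((2 * m + k : ℕ) : ℝ) by push_cast; ring, Real.rpow_natCast,
      pow_add, pow_mul, mul_pow d _ 2, Real.sq_sqrt hx, mul_comm]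
  rw [hGamma, hpow]
  push_cast
  ring

theorem rpow_half_mul_besselI_natCast (k : ℕ) (d : ℝ) {x : ℝ} (hx : 0 ≤ x) :
    ((x ^ ((k : ℝ) / 2) * besselI k (2 * d * √x) : ℝ) : ℂ) =
      (d : ℂ) ^ k * (x : ℂ) ^ k * regularized0F1 (k + 1) ((d ^ 2 * x : ℝ) : ℂ) := by
  have hpow : x ^ ((k : ℝ) / 2) * (d * √x) ^ k = d ^ k * x ^ k := by
    rw [Real.rpow_div_two_eq_sqrt _ hx, Real.rpow_natCast, ← mul_pow, mul_left_comm,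
      Real.mul_self_sqrt hx, mul_pow]
  rw [Complex.ofReal_mul, besselI_natCast k d hx, ← mul_assoc, ← Complex.ofReal_mul, hpow]
  push_cast
  ring

end Regularized0F1

section ContourRepresentation

/-- The entire function whose residues at `0, …, n`, after division by `t (t - 1) ⋯ (t - n)`,
are the terms of the sum defining `P_n(x)`. -/
noncomputable def entireFactorP (μ : ℝ) (ν : ℕ) (x : ℝ) (t : ℂ) : ℂ :=
  ((α μ ^ 2 - δ μ ^ 2 : ℝ) : ℂ) ^ t * (x : ℂ) ^ t * (Complex.Gamma (t + ν + 1))⁻¹ *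
    regularized0F1 (t + 1) ((δ μ ^ 2 * x : ℝ) : ℂ)

variable {μ x : ℝ}

theorem α_sq_sub_δ_sq (hμ : μ ≠ 0) : α μ ^ 2 - δ μ ^ 2 = 1 / μ := by
  rw [α, δ]
  field_simp
  ring

theorem α_sq_sub_δ_sq_pos (hμ : 0 < μ) : 0 < α μ ^ 2 - δ μ ^ 2 :=
  α_sq_sub_δ_sq hμ.ne' ▸ one_div_pos.mpr hμ

theorem differentiable_entireFactorP (hμ : μ ≠ 0) (ν : ℕ) (hx : x ≠ 0) :
    Differentiable ℂ (entireFactorP μ ν x) := by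
  have hA : ((α μ ^ 2 - δ μ ^ 2 : ℝ) : ℂ) ≠ 0 := by
    rw [α_sq_sub_δ_sq hμ]
    exact Complex.ofReal_ne_zero.mpr (one_div_ne_zero hμ)
  refine Differentiable.mul (Differentiable.mul (Differentiable.mul ?_ ?_) ?_) ?_
  · exact fun t => differentiableAt_id.const_cpow (Or.inl hA)
  · exact fun t => differentiableAt_id.const_cpow (Or.inl (Complex.ofReal_ne_zero.mpr hx))
  · exact Complex.differentiable_one_div_Gamma.comp (by fun_prop)
  · exact (differentiable_regularized0F1 _).comp (differentiable_id.add_const 1)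

theorem integrandP_eq_entireFactorP_div_prod (μ : ℝ) (ν n : ℕ) (x : ℝ) {t : ℂ}
    (ht : t ∉ range ((↑) : ℤ → ℂ)) :
    integrandP μ ν n x t =
      entireFactorP μ ν x t / ∏ j ∈ Finset.range (n + 1), (t - j) := by
  have ht_add_one : ∀ m : ℕ, t + 1 ≠ -m := fun m h => ht ⟨-m - 1, by
    push_cast
    linear_combination -h⟩
  have ht_sub : ∀ m : ℕ, t - n ≠ -m := fun m h => ht ⟨n - m, by
    push_cast
    linear_combination -h⟩
  have hGamma_add_one := Complex.Gamma_ne_zero ht_add_one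
  have hGamma_sub := Complex.Gamma_ne_zero ht_sub
  have hprod := Complex.Gamma_add_nat_div_Gamma_eq (n := n + 1) _ ht_sub
  rw [ascPochhammer_eval_sub_natCast,
    show t - n + ((n + 1 : ℕ) : ℂ) = t + 1 by push_cast; ring] at hprod
  rw [← hprod, entireFactorP, ← hypergeometric0F1_div_Gamma ht_add_one, integrandP]
  field_simp

variable {a : ℂ} {γ : Path a a} {n : ℕ}

theorem EncirclesOnce.natCast_notMem_range (hγ : EncirclesOnce γ n) :
    ∀ k ∈ Finset.range (n + 1), (k : ℂ) ∉ range γ :=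
  fun k hk => hγ.avoids k (Finset.mem_range_succ_iff.mp hk)

theorem EncirclesOnce.curveIntegrable_integrandP (hγ : EncirclesOnce γ n) (hμ : μ ≠ 0) (ν : ℕ)
    (hx : x ≠ 0) : CurveIntegrable (formDz (integrandP μ ν n x)) γ :=
  (curveIntegrable_formDz_congr_off_countable γ (countable_range _) fun _ _ ht =>
    integrandP_eq_entireFactorP_div_prod μ ν n x ht).mpr <|
    hγ.piecewiseC1.curveIntegrable_div_prod_sub (differentiable_entireFactorP hμ ν hx)
      hγ.natCast_notMem_range

theorem EncirclesOnce.contourIntegral_integrandP (hγ : EncirclesOnce γ n) (hμ : μ ≠ 0) (ν : ℕ)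
    (hx : x ≠ 0) :
    contourIntegral γ (integrandP μ ν n x) =
      2 * Real.pi * Complex.I * ∑ k ∈ Finset.range (n + 1),
        Lagrange.nodalWeight (Finset.range (n + 1)) (Nat.cast : ℕ → ℂ) k *
          entireFactorP μ ν x k := by
  rw [contourIntegral_congr_off_countable γ (countable_range _) fun _ _ ht =>
      integrandP_eq_entireFactorP_div_prod μ ν n x ht,
    hγ.piecewiseC1.contourIntegral_div_prod_sub (differentiable_entireFactorP hμ ν hx)
      Finset.nonempty_range_add_one Nat.cast_injective.injOn hγ.natCast_notMem_range]
  congr 1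
  refine Finset.sum_congr rfl fun k hk => ?_
  rw [hγ.winding k (Finset.mem_range_succ_iff.mp hk), mul_one]

theorem P_eq_sum_nodalWeight_mul_entireFactorP (hμ0 : 0 < μ) (hμ1 : μ ≠ 1) (ν n : ℕ)
    (hx : 0 ≤ x) :
    (P μ ν n x : ℂ) = ((ν + n).factorial : ℂ) * (n.factorial : ℂ) ^ 2 *
      (((α μ ^ 2 - δ μ ^ 2) ^ (1 / 2 : ℝ) : ℝ) : ℂ) *
        ∑ k ∈ Finset.range (n + 1),
          Lagrange.nodalWeight (Finset.range (n + 1)) (Nat.cast : ℕ → ℂ) k *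
            entireFactorP μ ν x k := by
  have hδ : (δ μ : ℂ) ≠ 0 := Complex.ofReal_ne_zero.mpr <|
    div_ne_zero (sub_ne_zero.mpr hμ1.symm) (mul_ne_zero two_ne_zero hμ0.ne')
  rw [P, Complex.ofReal_mul, Complex.ofReal_sum, Finset.mul_sum, Finset.mul_sum]
  refine Finset.sum_congr rfl fun k hk => ?_
  have hGamma : Complex.Gamma ((k : ℂ) + ν + 1) = ((ν + k).factorial : ℂ) := by
    rw [← Complex.Gamma_nat_eq_factorial, Nat.cast_add, add_comm (k : ℂ)]
  have hpochhammer : ((Polynomial.eval (-(n : ℝ)) (ascPochhammer ℝ k) : ℝ) : ℂ) =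
      (ascPochhammer ℂ k).eval (-(n : ℂ)) := by
    simp only [ascPochhammer_eval_neg_natCast]
    push_cast
    rfl
  have hnfac : (n.factorial : ℂ) ≠ 0 := by exact_mod_cast n.factorial_ne_zero
  rw [mul_assoc _ (x ^ ((k : ℝ) / 2)), Complex.ofReal_mul _ (x ^ ((k : ℝ) / 2) * _),
    rpow_half_mul_besselI_natCast k _ hx, entireFactorP, hGamma,
    nodalWeight_range_natCast (Finset.mem_range_succ_iff.mp hk),
    Real.rpow_add (α_sq_sub_δ_sq_pos hμ0), Real.rpow_natCast, Complex.cpow_natCast,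
    Complex.cpow_natCast]
  push_cast [hpochhammer]
  field_simp

end ContourRepresentation

section MulConvolution

/-- The multiplicative convolution `x ↦ ∫₀^∞ f (x / u) g u du / u` of two functions on `(0, ∞)`,
whose Mellin transform is the product of the Mellin transforms. -/
noncomputable def mulConvolution (f g : ℝ → ℂ) (x : ℝ) : ℂ :=
  ∫ u in Ioi 0, u⁻¹ • (g u * f (u⁻¹ * x))

variable {f g : ℝ → ℂ} {s : ℂ}

theorem cpow_mul_mulConvolution_integrand (f g : ℝ → ℂ) (s : ℂ) {x u : ℝ} (hx : 0 ≤ x)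
    (hu : 0 < u) :
    (x : ℂ) ^ s * u⁻¹ • (g u * f (u⁻¹ * x)) =
      (u : ℂ) ^ s * g u * u⁻¹ • (((u⁻¹ * x : ℝ) : ℂ) ^ s * f (u⁻¹ * x)) := by
  have hxu : (x : ℂ) ^ s = (u : ℂ) ^ s * ((u⁻¹ * x : ℝ) : ℂ) ^ s := by
    rw [← Complex.mul_cpow_ofReal_nonneg hu.le (by positivity), ← Complex.ofReal_mul,
      mul_inv_cancel_left₀ hu.ne']
  simp only [hxu, Complex.real_smul]
  ring

theorem integrable_prod_mulConvolution (hf : Measurable f) (hg : Measurable g)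
    (hfs : MellinConvergent f s) (hgs : MellinConvergent g s) :
    Integrable (fun p : ℝ × ℝ => (p.1 : ℂ) ^ (s - 1) * p.2⁻¹ • (g p.2 * f (p.2⁻¹ * p.1)))
      ((volume.restrict (Ioi 0)).prod (volume.restrict (Ioi 0))) := by
  have hmeas : Measurable
      fun p : ℝ × ℝ => (p.1 : ℂ) ^ (s - 1) * p.2⁻¹ • (g p.2 * f (p.2⁻¹ * p.1)) := by
    fun_prop
  refine (integrable_prod_iff' hmeas.aestronglyMeasurable).mpr ⟨?_, ?_⟩
  · filter_upwards [ae_restrict_mem measurableSet_Ioi] with u hu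
    have hconv := ((MellinConvergent.comp_mul_left (inv_pos.mpr hu)).mpr hfs).const_mul (u⁻¹ * g u)
    refine hconv.congr (Eventually.of_forall fun x => ?_)
    simp only [smul_eq_mul, Complex.real_smul, Complex.ofReal_inv]
    ring
  · refine (hgs.norm.mul_const (∫ x in Ioi (0 : ℝ), ‖(x : ℂ) ^ (s - 1) * f x‖)).congr ?_
    filter_upwards [ae_restrict_mem measurableSet_Ioi] with u hu
    have hscale := integral_comp_mul_left_Ioi' (fun x : ℝ => ‖(x : ℂ) ^ (s - 1) * f x‖) 0
      (inv_pos.mpr hu)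
    rw [mul_zero] at hscale
    rw [setIntegral_congr_fun measurableSet_Ioi fun x hx => congrArg norm
      (cpow_mul_mulConvolution_integrand f g (s - 1) (mem_Ioi.mp hx).le hu)]
    simp only [norm_mul _ (_ • _), norm_smul, Real.norm_of_nonneg (inv_pos.mpr hu).le,
      integral_const_mul, ← hscale, smul_eq_mul]

theorem hasMellin_mulConvolution (hf : Measurable f) (hg : Measurable g)
    (hfs : MellinConvergent f s) (hgs : MellinConvergent g s) :
    HasMellin (mulConvolution f g) s (mellin f s * mellin g s) := by
  have hint := integrable_prod_mulConvolution hf hg hfs hgs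
  have hconv : MellinConvergent (mulConvolution f g) s := by
    simpa only [MellinConvergent, IntegrableOn, mulConvolution, smul_eq_mul, integral_const_mul]
      using hint.integral_prod_left
  refine ⟨hconv, ?_⟩
  have hinner : ∀ u ∈ Ioi (0 : ℝ),
      ∫ x in Ioi (0 : ℝ), (x : ℂ) ^ (s - 1) * u⁻¹ • (g u * f (u⁻¹ * x)) =
        (u : ℂ) ^ (s - 1) * g u * mellin f s := by
    intro u hu
    rw [setIntegral_congr_fun measurableSet_Ioi fun x hx =>
      cpow_mul_mulConvolution_integrand f g (s - 1) (mem_Ioi.mp hx).le hu]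
    have hscale := integral_comp_mul_left_Ioi' (fun x : ℝ => (x : ℂ) ^ (s - 1) * f x) 0
      (inv_pos.mpr hu)
    rw [mul_zero] at hscale
    simp only [integral_const_mul, integral_smul, hscale, mellin, smul_eq_mul]
  calc mellin (mulConvolution f g) s
      = ∫ x in Ioi (0 : ℝ), ∫ u in Ioi (0 : ℝ),
          (x : ℂ) ^ (s - 1) * u⁻¹ • (g u * f (u⁻¹ * x)) := by
        simp only [mellin, mulConvolution, smul_eq_mul, integral_const_mul]
    _ = ∫ u in Ioi (0 : ℝ), ∫ x in Ioi (0 : ℝ),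
          (x : ℂ) ^ (s - 1) * u⁻¹ • (g u * f (u⁻¹ * x)) := integral_integral_swap hint
    _ = ∫ u in Ioi (0 : ℝ), (u : ℂ) ^ (s - 1) * g u * mellin f s :=
        setIntegral_congr_fun measurableSet_Ioi hinner
    _ = mellin f s * mellin g s := by
        rw [integral_mul_const, mul_comm]
        rfl

end MulConvolution

section BesselK

theorem sq_div_four_le_cosh (t : ℝ) : t ^ 2 / 4 ≤ Real.cosh t := by
  have hquad := Real.quadratic_le_exp_of_nonneg (abs_nonneg t)
  rw [sq_abs] at hquad
  rw [← Real.cosh_abs, Real.cosh_eq]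
  linarith [abs_nonneg t, Real.exp_pos (-|t|)]

theorem integrable_exp_neg_mul_cosh_mul_exp (κ : ℝ) {z : ℝ} (hz : 0 < z) :
    Integrable fun t => Real.exp (-z * Real.cosh t) * Real.exp (κ * t) := by
  have hgauss := (integrable_cexp_quadratic' (b := ((-(z / 4) : ℝ) : ℂ))
    (by rw [Complex.ofReal_re]; linarith) (κ : ℂ) 0).norm
  refine hgauss.mono' (by fun_prop) (Eventually.of_forall fun t => ?_)
  have hexponent : -z * Real.cosh t + κ * t ≤ -(z / 4) * t ^ 2 + κ * t := by
    linarith [mul_le_mul_of_nonneg_left (sq_div_four_le_cosh t) hz.le]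
  rw [← Real.exp_add, Real.norm_of_nonneg (Real.exp_nonneg _), Complex.norm_exp]
  refine (Real.exp_le_exp.mpr hexponent).trans_eq ?_
  norm_cast
  simp

theorem integral_exp_neg_mul_cosh_mul_exp (κ : ℝ) {z : ℝ} (hz : 0 < z) :
    ∫ t, Real.exp (-z * Real.cosh t) * Real.exp (κ * t) = 2 * besselK κ z := by
  have hint := integrable_exp_neg_mul_cosh_mul_exp κ hz
  have hneg := integral_comp_neg_Ioi 0 fun t => Real.exp (-z * Real.cosh t) * Real.exp (κ * t)
  rw [neg_zero] at hneg
  rw [← integral_add_compl (measurableSet_Iic (a := 0)) hint, compl_Iic, ← hneg,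
    ← integral_add hint.comp_neg.integrableOn hint.integrableOn, besselK,
    ← integral_const_mul]
  refine setIntegral_congr_fun measurableSet_Ioi fun t _ => ?_
  simp only [Real.cosh_neg, Real.cosh_eq (κ * t), mul_neg]
  ring

theorem integrable_exp_neg_mul_cosh_mul_cosh (κ : ℝ) {z : ℝ} (hz : 0 < z) :
    Integrable fun t => Real.exp (-z * Real.cosh t) * Real.cosh (κ * t) := by
  have hsum := (integrable_exp_neg_mul_cosh_mul_exp κ hz).add
    (integrable_exp_neg_mul_cosh_mul_exp (-κ) hz)
  refine (hsum.div_const 2).congr (Eventually.of_forall fun t => ?_)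
  simp only [Pi.add_apply, Real.cosh_eq (κ * t), neg_mul]
  ring

theorem continuousAt_besselK (κ : ℝ) {z : ℝ} (hz : 0 < z) : ContinuousAt (besselK κ) z := by
  refine continuousAt_of_dominated (Eventually.of_forall fun w => by fun_prop) ?_
    (integrable_exp_neg_mul_cosh_mul_cosh κ (half_pos hz)).integrableOn
    (Eventually.of_forall fun t => by fun_prop)
  filter_upwards [lt_mem_nhds (half_lt_self hz)] with w hw
  refine Eventually.of_forall fun t => ?_
  rw [Real.norm_of_nonneg (mul_nonneg (Real.exp_nonneg _) (Real.cosh_pos _).le)]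
  gcongr

theorem integral_comp_mul_exp {E : Type*} [NormedAddCommGroup E] [NormedSpace ℝ E] (g : ℝ → E)
    {a : ℝ} (ha : 0 < a) : ∫ t, g (a * Real.exp t) = ∫ u in Ioi 0, u⁻¹ • g u := by
  have himage : (fun t => a * Real.exp t) '' univ = Ioi 0 := by
    ext u
    refine ⟨?_, fun hu => ⟨Real.log (u / a), mem_univ _, ?_⟩⟩
    · rintro ⟨t, -, rfl⟩
      exact mul_pos ha (Real.exp_pos t)
    · simp only [Real.exp_log (div_pos hu ha), mul_div_cancel₀ _ ha.ne']
  have hderiv : ∀ t ∈ univ, HasDerivWithinAt (fun t => a * Real.exp t) (a * Real.exp t) univ t :=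
    fun t _ => ((Real.hasDerivAt_exp t).const_mul a).hasDerivWithinAt
  have hinj : univ.InjOn fun t => a * Real.exp t := fun t _ u _ htu =>
    Real.exp_injective (mul_left_cancel₀ ha.ne' htu)
  rw [← himage, integral_image_eq_integral_abs_deriv_smul MeasurableSet.univ hderiv hinj,
    setIntegral_univ]
  refine integral_congr_ae (Eventually.of_forall fun t => ?_)
  have hpos : 0 < a * Real.exp t := mul_pos ha (Real.exp_pos t)
  simp only [abs_of_pos hpos, smul_inv_smul₀ hpos.ne']

/-- The function `Y ↦ 2 Y^(κ/2) K_κ(2 √Y)`, the inverse Mellin transform of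
`s ↦ Γ(s) Γ(s + κ)`. -/
noncomputable def scaledBesselK (κ Y : ℝ) : ℝ :=
  2 * Y ^ (κ / 2) * besselK κ (2 * √Y)

theorem continuousAt_scaledBesselK (κ : ℝ) {Y : ℝ} (hY : 0 < Y) :
    ContinuousAt (scaledBesselK κ) Y := by
  have hbessel : ContinuousAt (fun Y => besselK κ (2 * √Y)) Y :=
    ContinuousAt.comp (f := fun Y => 2 * √Y) (continuousAt_besselK κ (by positivity)) (by fun_prop)
  exact ((Real.continuousAt_rpow_const Y (κ / 2) (Or.inl hY.ne')).const_mul 2).mul hbessel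

theorem hasMellin_exp_neg {s : ℂ} (hs : 0 < s.re) :
    HasMellin (fun u : ℝ => (Real.exp (-u) : ℂ)) s (Complex.Gamma s) := by
  refine ⟨?_, ?_⟩
  · refine (Complex.GammaIntegral_convergent hs).congr (Eventually.of_forall fun u => ?_)
    simp only [smul_eq_mul, Complex.ofReal_exp, Complex.ofReal_neg, mul_comm]
  · rw [Complex.Gamma_eq_integral hs, Complex.GammaIntegral_eq_mellin]

theorem hasMellin_cpow_smul_exp_neg {s a : ℂ} (hs : 0 < (s + a).re) :
    HasMellin (fun u : ℝ => (u : ℂ) ^ a • (Real.exp (-u) : ℂ)) s (Complex.Gamma (s + a)) :=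
  ⟨MellinConvergent.cpow_smul.mpr (hasMellin_exp_neg hs).1,
    (mellin_cpow_smul _ _ _).trans (hasMellin_exp_neg hs).2⟩

theorem mulConvolution_exp_neg_eq_scaledBesselK (κ : ℝ) {Y : ℝ} (hY : 0 < Y) :
    mulConvolution (fun u => (Real.exp (-u) : ℂ))
      (fun u => (u : ℂ) ^ (κ : ℂ) • (Real.exp (-u) : ℂ)) Y = scaledBesselK κ Y := by
  have hsqrt : 0 < √Y := Real.sqrt_pos.mpr hY
  have hkernel : ∀ t : ℝ,
      ((√Y * Real.exp t : ℝ) : ℂ) ^ (κ : ℂ) • (Real.exp (-(√Y * Real.exp t)) : ℂ) *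
          (Real.exp (-((√Y * Real.exp t)⁻¹ * Y)) : ℂ) =
        ((Y ^ (κ / 2) * (Real.exp (-(2 * √Y) * Real.cosh t) * Real.exp (κ * t)) : ℝ) : ℂ) := by
    intro t
    have hpow : (√Y * Real.exp t) ^ κ = Y ^ (κ / 2) * Real.exp (κ * t) := by
      rw [Real.mul_rpow hsqrt.le (Real.exp_nonneg t), ← Real.exp_mul, Real.sqrt_eq_rpow,
        ← Real.rpow_mul hY.le, mul_comm t]
      ring_nf
    have hcosh : -(√Y * Real.exp t) + -((√Y * Real.exp t)⁻¹ * Y) = -(2 * √Y) * Real.cosh t := by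
      have hinv : (√Y)⁻¹ * Y = √Y := by rw [inv_mul_eq_div, Real.div_sqrt]
      rw [mul_inv, ← Real.exp_neg, Real.cosh_eq]
      linear_combination (-Real.exp (-t)) * hinv
    rw [smul_eq_mul, ← Complex.ofReal_cpow (mul_pos hsqrt (Real.exp_pos t)).le, hpow,
      ← hcosh, Real.exp_add]
    push_cast
    ring
  rw [mulConvolution, ← integral_comp_mul_exp _ hsqrt]
  simp only [hkernel]
  rw [integral_complex_ofReal, integral_const_mul,
    integral_exp_neg_mul_cosh_mul_exp κ (mul_pos two_pos hsqrt), scaledBesselK]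
  ring_nf

theorem hasMellin_scaledBesselK {κ : ℝ} {s : ℂ} (hs : 0 < s.re) (hsκ : 0 < s.re + κ) :
    HasMellin (fun Y => (scaledBesselK κ Y : ℂ)) s
      (Complex.Gamma s * Complex.Gamma (s + κ)) := by
  have hf := hasMellin_exp_neg hs
  have hg := hasMellin_cpow_smul_exp_neg (s := s) (a := κ) (by simpa using hsκ)
  have hconv := hasMellin_mulConvolution (by fun_prop) (by fun_prop) hf.1 hg.1
  rw [hf.2, hg.2] at hconv
  have hcongr : EqOn
      (fun Y : ℝ => (Y : ℂ) ^ (s - 1) • mulConvolution (fun u => (Real.exp (-u) : ℂ))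
        (fun u => (u : ℂ) ^ (κ : ℂ) • (Real.exp (-u) : ℂ)) Y)
      (fun Y : ℝ => (Y : ℂ) ^ (s - 1) • (scaledBesselK κ Y : ℂ)) (Ioi 0) := fun Y hY => by
    simp only [mulConvolution_exp_neg_eq_scaledBesselK κ hY]
  exact ⟨hconv.1.congr_fun hcongr measurableSet_Ioi,
    (setIntegral_congr_fun measurableSet_Ioi hcongr).symm.trans hconv.2⟩

end BesselK

section VerticalLines

theorem norm_Gamma_le_Gamma_re {s : ℂ} (hs : 0 < s.re) :
    ‖Complex.Gamma s‖ ≤ Real.Gamma s.re := by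
  rw [Complex.Gamma_eq_integral hs, Complex.GammaIntegral, Real.Gamma_eq_integral hs]
  refine (norm_integral_le_integral_norm _).trans_eq ?_
  refine setIntegral_congr_fun measurableSet_Ioi fun u hu => ?_
  simp only [norm_mul, Complex.norm_real, Real.norm_of_nonneg (Real.exp_nonneg _),
    Complex.norm_cpow_eq_rpow_re_of_pos hu, Complex.sub_re, Complex.one_re]

theorem sq_norm_mul_norm_Gamma_le {s : ℂ} (hs : 0 < s.re) :
    ‖s‖ ^ 2 * ‖Complex.Gamma s‖ ≤ Real.Gamma (s.re + 2) := by
  have hs1 : 0 < (s + 1).re := by rw [Complex.add_re, Complex.one_re]; linarith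
  have hs0 : s ≠ 0 := fun h => by simp [h] at hs
  have hrec : Complex.Gamma (s + 2) = (s + 1) * (s * Complex.Gamma s) := by
    rw [← Complex.Gamma_add_one s hs0, ← Complex.Gamma_add_one (s + 1) fun h => by simp [h] at hs1]
    ring_nf
  have hle : ‖s‖ ≤ ‖s + 1‖ := by
    refine Real.sqrt_le_sqrt ?_
    simp only [Complex.normSq_apply, Complex.add_re, Complex.add_im, Complex.one_re,
      Complex.one_im]
    nlinarith
  calc ‖s‖ ^ 2 * ‖Complex.Gamma s‖ = ‖s‖ * (‖s‖ * ‖Complex.Gamma s‖) := by ring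
    _ ≤ ‖s + 1‖ * (‖s‖ * ‖Complex.Gamma s‖) := by gcongr
    _ = ‖Complex.Gamma (s + 2)‖ := by rw [hrec, norm_mul, norm_mul]
    _ ≤ Real.Gamma (s.re + 2) := by
      simpa using norm_Gamma_le_Gamma_re (s := s + 2) (by simp; linarith)

theorem continuous_Gamma_add_mul_I {c : ℝ} (hc : 0 < c) :
    Continuous fun τ : ℝ => Complex.Gamma (c + τ * Complex.I) := by
  refine continuous_iff_continuousAt.mpr fun τ => ?_
  refine ContinuousAt.comp (f := fun τ : ℝ => (c : ℂ) + τ * Complex.I)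
    (Complex.differentiableAt_Gamma _ fun m h => ?_).continuousAt (by fun_prop)
  have hre : c = -(m : ℝ) := by simpa using congrArg Complex.re h
  linarith [m.cast_nonneg (α := ℝ)]

theorem verticalIntegrable_Gamma {c : ℝ} (hc : 0 < c) :
    Complex.VerticalIntegrable Complex.Gamma c := by
  have hbound := (integrable_inv_one_add_sq.comp_div hc.ne').const_mul (Real.Gamma (c + 2) / c ^ 2)
  refine hbound.mono' (continuous_Gamma_add_mul_I hc).aestronglyMeasurable
    (Eventually.of_forall fun τ => ?_)
  have hre : ((c : ℂ) + τ * Complex.I).re = c := by simp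
  have hdecay := sq_norm_mul_norm_Gamma_le (s := c + τ * Complex.I) (by rwa [hre])
  have hnorm : ‖(c : ℂ) + τ * Complex.I‖ ^ 2 = c ^ 2 + τ ^ 2 := by
    rw [Complex.sq_norm, Complex.normSq_add_mul_I]
  rw [hre, hnorm, mul_comm, ← le_div_iff₀ (by positivity)] at hdecay
  refine hdecay.trans_eq ?_
  field_simp

theorem verticalIntegrable_Gamma_mul_Gamma_add {c κ : ℝ} (hc : 0 < c) (hcκ : 0 < c + κ) :
    Complex.VerticalIntegrable (fun s => Complex.Gamma s * Complex.Gamma (s + κ)) c := by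
  have hshift : ∀ τ : ℝ, (c : ℂ) + τ * Complex.I + κ = ((c + κ : ℝ) : ℂ) + τ * Complex.I :=
    fun τ => by push_cast; ring
  refine (verticalIntegrable_Gamma hc).mul_bdd (c := Real.Gamma (c + κ)) ?_
    (Eventually.of_forall fun τ => ?_)
  · simp only [hshift]
    exact (continuous_Gamma_add_mul_I hcκ).aestronglyMeasurable
  · simpa [hshift] using
      norm_Gamma_le_Gamma_re (s := ((c + κ : ℝ) : ℂ) + τ * Complex.I) (by simpa using hcκ)

theorem verticalIntegrable_mul_cpow_neg {F : ℂ → ℂ} {c Y : ℝ}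
    (hF : Complex.VerticalIntegrable F c) (hY : 0 < Y) :
    Complex.VerticalIntegrable (fun s => F s * (Y : ℂ) ^ (-s)) c := by
  have hY' : (Y : ℂ) ≠ 0 := Complex.ofReal_ne_zero.mpr hY.ne'
  have hcont : Continuous fun τ : ℝ => (Y : ℂ) ^ (-((c : ℂ) + τ * Complex.I)) :=
    Continuous.const_cpow (by fun_prop) (Or.inl hY')
  refine Integrable.mul_bdd (c := Y ^ (-c)) hF hcont.aestronglyMeasurable
    (Eventually.of_forall fun τ => ?_)
  rw [Complex.norm_cpow_eq_rpow_re_of_pos hY]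
  simp

theorem verticalIntegrable_Gamma_mul_Gamma_add_mul_cpow {c κ Y : ℝ} (hc : 0 < c)
    (hcκ : 0 < c + κ) (hY : 0 < Y) :
    Complex.VerticalIntegrable
      (fun s => Complex.Gamma s * Complex.Gamma (s + κ) * (Y : ℂ) ^ (-s)) c :=
  verticalIntegrable_mul_cpow_neg (verticalIntegrable_Gamma_mul_Gamma_add hc hcκ) hY

theorem verticalIntegral_mul_cpow_neg (F : ℂ → ℂ) (c Y : ℝ) :
    verticalIntegral c (fun s => F s * (Y : ℂ) ^ (-s)) =
      2 * Real.pi * Complex.I * mellinInv c F Y := by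
  have hpi : (Real.pi : ℂ) ≠ 0 := Complex.ofReal_ne_zero.mpr Real.pi_ne_zero
  rw [verticalIntegral, mellinInv, Complex.real_smul]
  simp only [smul_eq_mul, mul_comm (F _)]
  push_cast
  field_simp

theorem verticalIntegral_Gamma_mul_Gamma_add_mul_cpow {c κ Y : ℝ} (hc : 0 < c)
    (hcκ : 0 < c + κ) (hY : 0 < Y) :
    verticalIntegral c
        (fun s => Complex.Gamma s * Complex.Gamma (s + κ) * (Y : ℂ) ^ (-s)) =
      2 * Real.pi * Complex.I * scaledBesselK κ Y := by
  have hre : ∀ τ : ℝ, ((c : ℂ) + τ * Complex.I).re = c := fun τ => by simp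
  have hmellin : ∀ τ : ℝ, HasMellin (fun Y => (scaledBesselK κ Y : ℂ)) (c + τ * Complex.I) _ :=
    fun τ => hasMellin_scaledBesselK (by rwa [hre]) (by rwa [hre])
  have hconv : MellinConvergent (fun Y => (scaledBesselK κ Y : ℂ)) c := by simpa using (hmellin 0).1
  have hvert : Complex.VerticalIntegrable (mellin fun Y => (scaledBesselK κ Y : ℂ)) c :=
    (verticalIntegrable_Gamma_mul_Gamma_add hc hcκ).congr
      (Eventually.of_forall fun τ => (hmellin τ).2.symm)
  have hinv := mellinInv_mellin_eq c _ hY hconv hvert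
    (Complex.continuous_ofReal.continuousAt.comp (continuousAt_scaledBesselK κ hY))
  rw [verticalIntegral_mul_cpow_neg (fun s => Complex.Gamma s * Complex.Gamma (s + κ)), ← hinv]
  simp only [mellinInv, (hmellin _).2]

theorem verticalIntegral_finsetSum_const_mul {ι : Type*} (t : Finset ι) (a : ι → ℂ)
    {F : ι → ℂ → ℂ} {c : ℝ} (hF : ∀ i ∈ t, Complex.VerticalIntegrable (F i) c) :
    verticalIntegral c (fun s => ∑ i ∈ t, a i * F i s) =
      ∑ i ∈ t, a i * verticalIntegral c (F i) := by
  simp only [verticalIntegral]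
  rw [integral_finsetSum t fun i hi => (hF i hi).const_mul (a i), Finset.mul_sum]
  refine Finset.sum_congr rfl fun i _ => ?_
  rw [integral_const_mul, mul_left_comm]

theorem verticalLine_ae_eq_of_im_ne_zero {F G : ℂ → ℂ} {c : ℝ}
    (h : ∀ s : ℂ, s.re = c → s.im ≠ 0 → F s = G s) :
    (fun τ : ℝ => F (c + τ * Complex.I)) =ᵐ[volume] fun τ => G (c + τ * Complex.I) := by
  filter_upwards [compl_mem_ae_iff.mpr (measure_singleton (0 : ℝ))] with τ hτ
  exact h _ (by simp) (by simpa using hτ)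

end VerticalLines

section VerticalRepresentation

/-- The coefficient of `Γ(s) Γ(s + l + ν)` in
`Γ(s)² Γ(s + ν) / Γ(s - n) * ₂F₁(-n, ν + s; s - n; 1 - w)`. -/
noncomputable def coeffQ (ν n l : ℕ) (w : ℂ) : ℂ :=
  (-1) ^ n * (-1) ^ l * n.choose l * w ^ l * ((n + ν).factorial / (ν + l).factorial)

theorem Gamma_mul_terminatingGaussSum (ν n : ℕ) {s : ℂ} (hs : ∀ m : ℕ, s + ν ≠ -m) (r : ℂ) :
    Complex.Gamma (s + ν) * terminatingGaussSum n (ν + s) (s - n) r =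
      ∑ l ∈ Finset.range (n + 1), coeffQ ν n l (1 - r) * Complex.Gamma (s + (l + ν)) := by
  have hG := Complex.Gamma_ne_zero hs
  have htransform := terminatingGaussSum_one_sub n (ν + s) (ν + 1) r
  rw [show (ν : ℂ) + s - (ν + 1) - n + 1 = s - n by ring] at htransform
  rw [htransform, terminatingGaussSum, Finset.Nat.sum_antidiagonal_eq_sum_range_succ_mk,
    Finset.mul_sum, Finset.mul_sum]
  refine Finset.sum_congr rfl fun l hl => ?_
  have hfactorial := ascPochhammer_eval_natCast_add_one (K := ℂ) (ν + l) (n - l)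
  rw [show ν + l + (n - l) = n + ν by have := Finset.mem_range_succ_iff.mp hl; lia] at hfactorial
  push_cast at hfactorial
  have hGamma := Complex.Gamma_add_nat_div_Gamma_eq (n := l) _ hs
  rw [show s + ν + (l : ℂ) = s + (l + ν) by ring] at hGamma
  rw [show (ν : ℂ) + 1 + l = ν + l + 1 by ring, hfactorial, add_comm (ν : ℂ) s, ← hGamma,
    neg_pow (1 - r), coeffQ]
  field_simp

theorem Gamma_sq_mul_Gamma_div_mul_ordinaryHypergeometric (ν n : ℕ) {s : ℂ}
    (hs : ∀ m : ℕ, s - n ≠ -m) (r : ℂ) :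
    Complex.Gamma s ^ 2 * Complex.Gamma (s + ν) / Complex.Gamma (s - n) *
        ordinaryHypergeometric (-(n : ℂ)) ((ν : ℂ) + s) (s - n) r =
      ∑ l ∈ Finset.range (n + 1),
        coeffQ ν n l (1 - r) * (Complex.Gamma s * Complex.Gamma (s + ((l + ν : ℝ) : ℂ))) := by
  have hsν : ∀ m : ℕ, s + ν ≠ -m := fun m h => hs (m + ν + n) <| by
    push_cast
    linear_combination h
  have hG := Complex.Gamma_ne_zero hs
  have hquot : Complex.Gamma s / Complex.Gamma (s - n) = (ascPochhammer ℂ n).eval (s - n) := by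
    simpa using Complex.Gamma_add_nat_div_Gamma_eq (n := n) _ hs
  have hG0 : Complex.Gamma s ≠ 0 := Complex.Gamma_ne_zero fun m h => hs (m + n) <| by
    push_cast
    linear_combination h
  calc Complex.Gamma s ^ 2 * Complex.Gamma (s + ν) / Complex.Gamma (s - n) *
        ordinaryHypergeometric (-(n : ℂ)) ((ν : ℂ) + s) (s - n) r
      = Complex.Gamma s * (Complex.Gamma (s + ν) * ((ascPochhammer ℂ n).eval (s - n) *
          ordinaryHypergeometric (-(n : ℂ)) ((ν : ℂ) + s) (s - n) r)) := by
        rw [← hquot]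
        ring
    _ = Complex.Gamma s *
          (Complex.Gamma (s + ν) * terminatingGaussSum n (ν + s) (s - n) r) := by
        rw [ascPochhammer_mul_ordinaryHypergeometric_neg_natCast n _ _
          (hquot ▸ div_ne_zero hG0 hG)]
    _ = _ := by
        rw [Gamma_mul_terminatingGaussSum ν n hsν, Finset.mul_sum]
        refine Finset.sum_congr rfl fun l _ => ?_
        push_cast
        ring

theorem integrandQ_eq_sum (μ : ℝ) (ν n : ℕ) (y : ℝ) {s : ℂ} (hs : s.im ≠ 0) :
    integrandQ μ ν n y s = ∑ l ∈ Finset.range (n + 1),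
      coeffQ ν n l (1 - ((δ μ ^ 2 / α μ ^ 2 : ℝ) : ℂ)) *
        (Complex.Gamma s * Complex.Gamma (s + ((l + ν : ℝ) : ℂ)) *
          ((α μ ^ 2 * y : ℝ) : ℂ) ^ (-s)) := by
  rw [integrandQ, Gamma_sq_mul_Gamma_div_mul_ordinaryHypergeometric ν n fun m h => hs <| by
    simpa using congrArg Complex.im h, Finset.sum_mul]
  simp only [mul_assoc]

variable {μ y c : ℝ}

theorem verticalIntegrable_integrandQ (hα : α μ ≠ 0) (ν n : ℕ) (hy : 0 < y) (hc : 0 < c) :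
    Complex.VerticalIntegrable (integrandQ μ ν n y) c := by
  have hcκ : ∀ l : ℕ, 0 < c + ((l : ℝ) + ν) := fun l => by positivity
  have hY : 0 < α μ ^ 2 * y := by positivity
  exact Integrable.congr (integrable_finsetSum _ fun l _ => Integrable.const_mul
    (verticalIntegrable_Gamma_mul_Gamma_add_mul_cpow hc (hcκ l) hY) _)
    (verticalLine_ae_eq_of_im_ne_zero fun s _ hs => (integrandQ_eq_sum μ ν n y hs).symm)

theorem verticalIntegral_integrandQ (hα : α μ ≠ 0) (ν n : ℕ) (hy : 0 < y) (hc : 0 < c) :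
    verticalIntegral c (integrandQ μ ν n y) = 2 * Real.pi * Complex.I *
      ∑ l ∈ Finset.range (n + 1), coeffQ ν n l (1 - ((δ μ ^ 2 / α μ ^ 2 : ℝ) : ℂ)) *
        scaledBesselK (l + ν) (α μ ^ 2 * y) := by
  have hcκ : ∀ l : ℕ, 0 < c + ((l : ℝ) + ν) := fun l => by positivity
  have hY : 0 < α μ ^ 2 * y := by positivity
  calc verticalIntegral c (integrandQ μ ν n y)
      = verticalIntegral c fun s => ∑ l ∈ Finset.range (n + 1),
          coeffQ ν n l (1 - ((δ μ ^ 2 / α μ ^ 2 : ℝ) : ℂ)) *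
            (Complex.Gamma s * Complex.Gamma (s + ((l + ν : ℝ) : ℂ)) *
              ((α μ ^ 2 * y : ℝ) : ℂ) ^ (-s)) :=
        congrArg (Complex.I * ·) <| integral_congr_ae <|
          verticalLine_ae_eq_of_im_ne_zero fun s _ hs => integrandQ_eq_sum μ ν n y hs
    _ = ∑ l ∈ Finset.range (n + 1), coeffQ ν n l (1 - ((δ μ ^ 2 / α μ ^ 2 : ℝ) : ℂ)) *
          (2 * Real.pi * Complex.I * scaledBesselK (l + ν) (α μ ^ 2 * y)) := by
        rw [verticalIntegral_finsetSum_const_mul _ _ fun l _ =>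
          verticalIntegrable_Gamma_mul_Gamma_add_mul_cpow hc (hcκ l) hY]
        simp only [verticalIntegral_Gamma_mul_Gamma_add_mul_cpow hc (hcκ _) hY]
    _ = _ := by simp only [Finset.mul_sum, mul_left_comm]

theorem scaledBesselK_sq_mul (κ : ℝ) {a : ℝ} (ha : 0 ≤ a) (hy : 0 ≤ y) :
    scaledBesselK κ (a ^ 2 * y) = 2 * a ^ κ * y ^ (κ / 2) * besselK κ (2 * a * √y) := by
  have hpow : (a ^ 2 * y) ^ (κ / 2) = a ^ κ * y ^ (κ / 2) := by
    rw [Real.mul_rpow (by positivity) hy, ← Real.rpow_natCast a 2, ← Real.rpow_mul ha]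
    ring_nf
  rw [scaledBesselK, hpow, Real.sqrt_mul (by positivity), Real.sqrt_sq ha, ← mul_assoc 2 a,
    ← mul_assoc 2]

theorem Q_eq_sum_coeffQ_mul_scaledBesselK (hμ : 0 < μ) (ν n : ℕ) (hy : 0 ≤ y) :
    (Q μ ν n y : ℂ) =
      1 / ((n.factorial : ℂ) ^ 2 * ((n + ν).factorial : ℂ)) *
        (((1 - δ μ ^ 2 / α μ ^ 2) ^ ν : ℝ) : ℂ) *
        (((α μ ^ 2 - δ μ ^ 2) ^ (1 / 2 : ℝ) : ℝ) : ℂ) *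
        ∑ l ∈ Finset.range (n + 1), coeffQ ν n l (1 - ((δ μ ^ 2 / α μ ^ 2 : ℝ) : ℂ)) *
          scaledBesselK (l + ν) (α μ ^ 2 * y) := by
  have hα : 0 < α μ := div_pos (by linarith) (by linarith)
  rw [Q, Complex.ofReal_mul, Complex.ofReal_sum, Finset.mul_sum, Finset.mul_sum]
  refine Finset.sum_congr rfl fun l _ => ?_
  have hApow : (α μ ^ 2 - δ μ ^ 2) ^ ((l : ℝ) + ν + 1 / 2) =
      (α μ ^ 2) ^ (l + ν) * (1 - δ μ ^ 2 / α μ ^ 2) ^ (l + ν) *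
        (α μ ^ 2 - δ μ ^ 2) ^ (1 / 2 : ℝ) := by
    rw [Real.rpow_add (α_sq_sub_δ_sq_pos hμ), ← Nat.cast_add, Real.rpow_natCast, ← mul_pow]
    congr 2
    field_simp
  have hαpow : α μ ^ ((l : ℝ) + ν) = α μ ^ (l + ν) := by
    rw [← Nat.cast_add, Real.rpow_natCast]
  have hnfac : (n.factorial : ℂ) ≠ 0 := Nat.cast_ne_zero.mpr n.factorial_ne_zero
  have hnνfac : ((n + ν).factorial : ℂ) ≠ 0 := Nat.cast_ne_zero.mpr (n + ν).factorial_ne_zero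
  have hνlfac : ((ν + l).factorial : ℂ) ≠ 0 := Nat.cast_ne_zero.mpr (ν + l).factorial_ne_zero
  have hlfac : (l.factorial : ℂ) ≠ 0 := Nat.cast_ne_zero.mpr l.factorial_ne_zero
  have hα' : (α μ : ℂ) ≠ 0 := Complex.ofReal_ne_zero.mpr hα.ne'
  rw [hApow, ascPochhammer_eval_neg_natCast, scaledBesselK_sq_mul _ hα.le hy, hαpow, coeffQ]
  push_cast
  generalize (1 : ℂ) - δ μ ^ 2 / α μ ^ 2 = w
  field_simp
  ring

end VerticalRepresentation

end DependentGaussian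

theorem mainTheorem7_general (μ : ℝ) (hμ : 0 < μ) (ν n : ℕ) :
    (μ ≠ 1 → ∀ (x : ℝ), 0 < x → ∀ (a : ℂ) (γ : Path a a), EncirclesOnce γ n →
      CurveIntegrable (formDz (integrandP μ ν n x)) γ ∧
      (P μ ν n x : ℂ) =
        1 / (2 * Real.pi * Complex.I) * ((ν + n).factorial : ℂ) * (n.factorial : ℂ) ^ 2 *
          (((α μ ^ 2 - δ μ ^ 2) ^ (1 / 2 : ℝ) : ℝ) : ℂ) *
          contourIntegral γ (integrandP μ ν n x)) ∧
    (∀ (y : ℝ), 0 < y → ∀ (c : ℝ), 0 < c →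
      Complex.VerticalIntegrable (integrandQ μ ν n y) c ∧
      (Q μ ν n y : ℂ) =
        1 / (2 * Real.pi * Complex.I * (n.factorial : ℂ) ^ 2 * ((n + ν).factorial : ℂ)) *
          (((1 - δ μ ^ 2 / α μ ^ 2) ^ ν : ℝ) : ℂ) *
          (((α μ ^ 2 - δ μ ^ 2) ^ (1 / 2 : ℝ) : ℝ) : ℂ) *
          verticalIntegral c (integrandQ μ ν n y)) := by
  have hα : α μ ≠ 0 := (div_pos (by linarith) (by linarith) : 0 < (1 + μ) / (2 * μ)).ne'
  have hpi := Complex.two_pi_I_ne_zero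
  refine ⟨fun hμ1 x hx a γ hγ => ⟨hγ.curveIntegrable_integrandP hμ.ne' ν hx.ne', ?_⟩,
    fun y hy c hc => ⟨verticalIntegrable_integrandQ hα ν n hy hc, ?_⟩⟩
  · rw [P_eq_sum_nodalWeight_mul_entireFactorP hμ hμ1 ν n hx.le,
      hγ.contourIntegral_integrandP hμ.ne' ν hx.ne']
    generalize 2 * (Real.pi : ℂ) * Complex.I = p at hpi ⊢
    field_simp
  · rw [Q_eq_sum_coeffQ_mul_scaledBesselK hμ ν n hy.le, verticalIntegral_integrandQ hα ν n hy hc]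
    generalize 2 * (Real.pi : ℂ) * Complex.I = p at hpi ⊢
    field_simp

theorem mainTheorem7 (μ : ℝ) (hμ0 : 0 < μ) (hμ1 : μ < 1) (ν n : ℕ) :
    (∀ (x : ℝ), 0 < x → ∀ (a : ℂ) (γ : Path a a), EncirclesOnce γ n →
      CurveIntegrable (formDz (integrandP μ ν n x)) γ ∧
      (P μ ν n x : ℂ) =
        1 / (2 * Real.pi * Complex.I) * ((ν + n).factorial : ℂ) * (n.factorial : ℂ) ^ 2 *
          (((α μ ^ 2 - δ μ ^ 2) ^ (1 / 2 : ℝ) : ℝ) : ℂ) *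
          contourIntegral γ (integrandP μ ν n x)) ∧
    (∀ (y : ℝ), 0 < y → ∀ (c : ℝ), 0 < c →
      Complex.VerticalIntegrable (integrandQ μ ν n y) c ∧
      (Q μ ν n y : ℂ) =
        1 / (2 * Real.pi * Complex.I * (n.factorial : ℂ) ^ 2 * ((n + ν).factorial : ℂ)) *
          (((1 - δ μ ^ 2 / α μ ^ 2) ^ ν : ℝ) : ℂ) *
          (((α μ ^ 2 - δ μ ^ 2) ^ (1 / 2 : ℝ) : ℝ) : ℂ) *
          verticalIntegral c (integrandQ μ ν n y)) :=
  (mainTheorem7_general μ hμ0 ν n).imp_left fun h => h hμ1.ne
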